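/- Let $d\in\mathbb{N}$ and let $1<p<\infty$. For $x\in\mathbb{R}^d$ write $x^2=x_1^2+\cdots+x_d^2$, $|x|=\sqrt{x^2}$, and for $z\in\mathbb{C}^d$ write $z^2=z_1^2+\cdots+z_d^2$. Let $\rho(x)=(2\pi)^{-d/2}e^{-x^2/2}$, and let $L^p(\mathbb{R}^d,\rho)$ be the space of complex-valued functions that are $L^p$ with respect to the Gaussian measure $\rho(x)\,dx$. For $f\in L^p(\mathbb{R}^d,\rho)$ the Segal--Bargmann transform of $f$ is $$Sf(z)=(2\pi)^{-d/2}\int_{\mathbb{R}^d}e^{-(z-x)^2/2}f(x)\,dx,\qquad z\in\mathbb{C}^d.$$ Suppose that $F$ is a holomorphic function on $\mathbb{C}^d$. Then the following two conditions are equivalent. 1. For every $n\in\mathbb{N}$ there exists a constant $C_n$ such that for all $x,y\in\mathbb{R}^d$ $$|F(x+iy)|\le C_n\,e^{y^2/2}\,e^{x^2/(2(p-1))}\,\frac{1}{(1+|x|)^n(1+|y|)^n}.$$ 2. There exists $f\in L^p(\mathbb{R}^d,\rho)$ such that $Sf=F$, where $f$ is smooth ($C^\infty$) and has the property that for all multi-indices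 $\alpha,\beta$ $$x^\alpha\left(\frac{\partial}{\partial x}\right)^{\beta}f(x)\in L^p(\mathbb{R}^d,\rho).$$ -/

import Mathlib

open MeasureTheory
open scoped ContDiff

noncomputable section

namespace SegalBargmann

/-- The standard Gaussian density `ρ(x) = (2π)^{-d/2} e^{-x²/2}` on `ℝ^d`. -/
def rho (d : ℕ) (x : EuclideanSpace ℝ (Fin d)) : ℝ :=
  (2 * Real.pi) ^ (-(d : ℝ) / 2) * Real.exp (-(∑ j, x j ^ 2) / 2)

/-- The entire analytic continuation of `ρ` to `ℂ^d`; here `z² = z₁² + ⋯ + z_d²`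
(no complex conjugation). -/
def rhoC (d : ℕ) (z : EuclideanSpace ℂ (Fin d)) : ℂ :=
  (((2 * Real.pi) ^ (-(d : ℝ) / 2) : ℝ) : ℂ) * Complex.exp (-(∑ j, z j ^ 2) / 2)

/-- The Gaussian measure `ρ(x) dx` on `ℝ^d`. -/
def gaussianMeasure (d : ℕ) : Measure (EuclideanSpace ℝ (Fin d)) :=
  volume.withDensity fun x => ENNReal.ofReal (rho d x)

/-- The point `x + iy` of `ℂ^d`, for `x, y ∈ ℝ^d`. -/
def complexPoint {d : ℕ} (x y : EuclideanSpace ℝ (Fin d)) : EuclideanSpace ℂ (Fin d) :=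
  WithLp.toLp 2 fun j => (x j : ℂ) + Complex.I * (y j : ℂ)

/-- The Segal-Bargmann transform `Sf(z) = ∫ ρ(z - x) f(x) dx`, `z ∈ ℂ^d`. -/
def transform {d : ℕ} (f : EuclideanSpace ℝ (Fin d) → ℂ) (z : EuclideanSpace ℂ (Fin d)) : ℂ :=
  ∫ x : EuclideanSpace ℝ (Fin d), rhoC d (z - complexPoint x 0) * f x

/-- The monomial `x^α`, for a multi-index `α`. -/
def monomial {d : ℕ} (α : Fin d → ℕ) (x : EuclideanSpace ℝ (Fin d)) : ℝ :=
  ∏ j, x j ^ α j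

/-- The partial derivative `∂f/∂x_k`. -/
def partialDeriv {d : ℕ} (k : Fin d) (f : EuclideanSpace ℝ (Fin d) → ℂ) :
    EuclideanSpace ℝ (Fin d) → ℂ :=
  fun x => lineDeriv ℝ f x (EuclideanSpace.single k 1)

/-- The derivative `(∂/∂x)^β f = (∂/∂x₁)^{β₁} ⋯ (∂/∂x_d)^{β_d} f`, for a multi-index `β`. -/
def multiDeriv {d : ℕ} (β : Fin d → ℕ) (f : EuclideanSpace ℝ (Fin d) → ℂ) :
    EuclideanSpace ℝ (Fin d) → ℂ :=
  (List.finRange d).foldr (fun k g => (partialDeriv k)^[β k] g) f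

end SegalBargmann

end

open MeasureTheory
open scoped ContDiff FourierTransform

noncomputable section

namespace SegalBargmann

variable {d : ℕ}

/-! Both directions rest on the fact that `S` intertwines multiplication by `z_k` with `x_k - ∂_k`,
so polynomial decay of `Sf` corresponds to polynomial weights and derivatives of `f`.

From the bounds to `f`: on a slice `u + iℝ^d`, `S` is a Fourier transform up to Gaussian factors, so
the candidate is `f(x) = (2π)^{-d/2} ∫ F(iv) e^{(iv-x)²/2} dv`. By Cauchy
(`integral_complexPoint_eq`) the integral may be moved to any `u + iℝ^d`; the optimal `u = ((p-1)/p)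
x` gives decay faster than any power relative to `e^{x²/(2p)}`
(`RapidBound.rapidDecay_inverseTransform`), hence membership in `L^p(ρ)`. Since `∂_k f` is `x_k f`
minus the inverse transform of `z_k F`, and the growth condition survives multiplication by `z_k`,
all derivatives decay likewise. Fourier inversion on each slice gives `Sf = F`.

From `f` to the bounds: Hölder's inequality gives the case `n = 0` (`norm_transform_le`).
Integration by parts gives `z_k Sf = S(x_k f - ∂_k f)` (`coord_mul_transform`), whose right-hand
side is again the transform of an admissible function; iterating yields every power. -/

/-! ### Iterated partial derivatives. -/

lemma partialDeriv_eq_fderiv {f : EuclideanSpace ℝ (Fin d) → ℂ} (hf : Differentiable ℝ f)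
    (k : Fin d) :
    partialDeriv k f = fun x => fderiv ℝ f x (EuclideanSpace.single k 1) :=
  funext fun x => (hf x).lineDeriv_eq_fderiv

lemma contDiff_partialDeriv {f : EuclideanSpace ℝ (Fin d) → ℂ} (hf : ContDiff ℝ ∞ f)
    (k : Fin d) : ContDiff ℝ ∞ (partialDeriv k f) := by
  rw [partialDeriv_eq_fderiv (hf.differentiable (by simp))]
  exact (hf.fderiv_right (m := ∞) (by simp)).clm_apply contDiff_const

lemma partialDeriv_comm {f : EuclideanSpace ℝ (Fin d) → ℂ} (hf : ContDiff ℝ ∞ f)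
    (j k : Fin d) :
    partialDeriv j (partialDeriv k f) = partialDeriv k (partialDeriv j f) := by
  have hd : Differentiable ℝ (fderiv ℝ f) :=
    (hf.fderiv_right (m := ∞) (by simp)).differentiable (by simp)
  have key : ∀ i l : Fin d, partialDeriv i (partialDeriv l f) = fun x =>
      fderiv ℝ (fderiv ℝ f) x (EuclideanSpace.single i 1) (EuclideanSpace.single l 1) := by
    intro i l
    rw [partialDeriv_eq_fderiv ((contDiff_partialDeriv hf l).differentiable (by simp)),
      partialDeriv_eq_fderiv (hf.differentiable (by simp))]
    funext x
    rw [fderiv_clm_apply (hd x) (differentiableAt_const _)]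
    simp
  rw [key, key]
  funext x
  exact (hf.contDiffAt.isSymmSndFDerivAt (by
    simpa using WithTop.coe_le_coe.2 (le_top : (2 : ℕ∞) ≤ ⊤))).eq _ _

lemma contDiff_iterate_partialDeriv {f : EuclideanSpace ℝ (Fin d) → ℂ} (hf : ContDiff ℝ ∞ f)
    (k : Fin d) (n : ℕ) : ContDiff ℝ ∞ ((partialDeriv k)^[n] f) := by
  induction n with
  | zero => exact hf
  | succ n ih => rw [Function.iterate_succ_apply']; exact contDiff_partialDeriv ih k

lemma partialDeriv_iterate_comm {f : EuclideanSpace ℝ (Fin d) → ℂ} (hf : ContDiff ℝ ∞ f)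
    (j k : Fin d) (n : ℕ) :
    partialDeriv j ((partialDeriv k)^[n] f) = (partialDeriv k)^[n] (partialDeriv j f) := by
  induction n with
  | zero => rfl
  | succ n ih =>
    rw [Function.iterate_succ_apply', Function.iterate_succ_apply', ← ih,
      partialDeriv_comm (contDiff_iterate_partialDeriv hf k n)]

lemma contDiff_foldr_partialDeriv {f : EuclideanSpace ℝ (Fin d) → ℂ} (hf : ContDiff ℝ ∞ f)
    (β : Fin d → ℕ) (l : List (Fin d)) :
    ContDiff ℝ ∞ (l.foldr (fun k g => (partialDeriv k)^[β k] g) f) := by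
  induction l with
  | nil => exact hf
  | cons a l ih => exact contDiff_iterate_partialDeriv ih a _

/-- Mixed partials commute, so `∂_k` can be moved inward to the block of `k`; without repetitions in
the list, exactly one block grows. -/
lemma partialDeriv_foldr {f : EuclideanSpace ℝ (Fin d) → ℂ} (hf : ContDiff ℝ ∞ f)
    (β : Fin d → ℕ) (k : Fin d) (l : List (Fin d)) (hl : l.Nodup) (hk : k ∈ l) :
    partialDeriv k (l.foldr (fun k g => (partialDeriv k)^[β k] g) f) =
      l.foldr (fun j g => (partialDeriv j)^[(β + Pi.single k 1 : Fin d → ℕ) j] g) f := by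
  induction l with
  | nil => simp at hk
  | cons a l ih =>
    rw [List.nodup_cons] at hl
    simp only [List.foldr_cons]
    by_cases hka : k = a
    · subst hka
      have hcongr : l.foldr (fun j g => (partialDeriv j)^[(β + Pi.single k 1 : Fin d → ℕ) j] g) f =
          l.foldr (fun j g => (partialDeriv j)^[β j] g) f := by
        refine List.foldr_ext _ _ _ fun j hj g => ?_
        have hjk : j ≠ k := fun h => hl.1 (h ▸ hj)
        simp [hjk]
      rw [hcongr]
      simp [Function.iterate_succ_apply']
    · rw [partialDeriv_iterate_comm (contDiff_foldr_partialDeriv hf β l),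
        ih hl.2 ((List.mem_cons.1 hk).resolve_left hka)]
      simp [Ne.symm hka]

lemma contDiff_multiDeriv {f : EuclideanSpace ℝ (Fin d) → ℂ} (hf : ContDiff ℝ ∞ f)
    (β : Fin d → ℕ) : ContDiff ℝ ∞ (multiDeriv β f) :=
  contDiff_foldr_partialDeriv hf β _

lemma partialDeriv_multiDeriv {f : EuclideanSpace ℝ (Fin d) → ℂ} (hf : ContDiff ℝ ∞ f)
    (β : Fin d → ℕ) (k : Fin d) :
    partialDeriv k (multiDeriv β f) = multiDeriv (β + Pi.single k 1) f :=
  partialDeriv_foldr hf β k _ (List.nodup_finRange d) (List.mem_finRange k)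

lemma multiDeriv_zero (f : EuclideanSpace ℝ (Fin d) → ℂ) : multiDeriv 0 f = f := by
  unfold multiDeriv
  induction List.finRange d with
  | nil => rfl
  | cons a l ih => simp

/-! ### Monomials and closure under multiplication by coordinates. -/

lemma monomial_zero (x : EuclideanSpace ℝ (Fin d)) : monomial 0 x = 1 := by
  simp [monomial]

lemma monomial_add_single (α : Fin d → ℕ) (j : Fin d) (x : EuclideanSpace ℝ (Fin d)) :
    monomial (α + Pi.single j 1) x = monomial α x * x j := by
  simp only [monomial, Pi.add_apply, pow_add, Finset.prod_mul_distrib]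
  congr 1
  rw [Finset.prod_eq_single j] <;> simp +contextual

/-- The closure of a set of functions under sums, differences and multiplication by the
coordinate functions. -/
inductive CoordSpan (B : Set (EuclideanSpace ℝ (Fin d) → ℂ)) :
    (EuclideanSpace ℝ (Fin d) → ℂ) → Prop
  | base {f} (hf : f ∈ B) : CoordSpan B f
  | coord (j : Fin d) {f} (hf : CoordSpan B f) : CoordSpan B (fun x => (x j : ℂ) * f x)
  | add {f g} (hf : CoordSpan B f) (hg : CoordSpan B g) : CoordSpan B (fun x => f x + g x)
  | sub {f g} (hf : CoordSpan B f) (hg : CoordSpan B g) : CoordSpan B (fun x => f x - g x)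

lemma contDiff_coord (j : Fin d) :
    ContDiff ℝ ∞ (fun x : EuclideanSpace ℝ (Fin d) => (x j : ℂ)) :=
  Complex.ofRealCLM.contDiff.comp (EuclideanSpace.proj (𝕜 := ℝ) j).contDiff

lemma hasFDerivAt_coord (j : Fin d) (x : EuclideanSpace ℝ (Fin d)) :
    HasFDerivAt (fun x : EuclideanSpace ℝ (Fin d) => (x j : ℂ))
      (Complex.ofRealCLM.comp (EuclideanSpace.proj (𝕜 := ℝ) j)) x :=
  (Complex.ofRealCLM.comp (EuclideanSpace.proj (𝕜 := ℝ) j)).hasFDerivAt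

lemma partialDeriv_add {f g : EuclideanSpace ℝ (Fin d) → ℂ} (hf : Differentiable ℝ f)
    (hg : Differentiable ℝ g) (k : Fin d) :
    partialDeriv k (fun x => f x + g x) = fun x => partialDeriv k f x + partialDeriv k g x := by
  funext x
  rw [partialDeriv_eq_fderiv hf, partialDeriv_eq_fderiv hg, partialDeriv_eq_fderiv (hf.fun_add hg)]
  simp [fderiv_fun_add (hf x) (hg x)]

lemma partialDeriv_sub {f g : EuclideanSpace ℝ (Fin d) → ℂ} (hf : Differentiable ℝ f)
    (hg : Differentiable ℝ g) (k : Fin d) :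
    partialDeriv k (fun x => f x - g x) = fun x => partialDeriv k f x - partialDeriv k g x := by
  funext x
  rw [partialDeriv_eq_fderiv hf, partialDeriv_eq_fderiv hg, partialDeriv_eq_fderiv (hf.fun_sub hg)]
  simp [fderiv_fun_sub (hf x) (hg x)]

lemma partialDeriv_coord_mul {f : EuclideanSpace ℝ (Fin d) → ℂ} (hf : Differentiable ℝ f)
    (j k : Fin d) :
    partialDeriv k (fun x => (x j : ℂ) * f x) =
      fun x => (x j : ℂ) * partialDeriv k f x + if j = k then f x else 0 := by
  funext x
  have hc := hasFDerivAt_coord j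
  rw [partialDeriv_eq_fderiv hf,
    partialDeriv_eq_fderiv (fun y => (hc y).differentiableAt.fun_mul (hf y))]
  beta_reduce
  rw [((hc x).fun_mul (hf x).hasFDerivAt).fderiv]
  by_cases h : j = k <;> simp [h]

lemma CoordSpan.contDiff {B : Set (EuclideanSpace ℝ (Fin d) → ℂ)}
    (hB : ∀ f ∈ B, ContDiff ℝ ∞ f) {f : EuclideanSpace ℝ (Fin d) → ℂ} (hf : CoordSpan B f) :
    ContDiff ℝ ∞ f := by
  induction hf with
  | base hf => exact hB _ hf
  | coord j _ ih => exact (contDiff_coord j).mul ih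
  | add _ _ ih ih' => exact ih.add ih'
  | sub _ _ ih ih' => exact ih.sub ih'

lemma CoordSpan.partialDeriv {B : Set (EuclideanSpace ℝ (Fin d) → ℂ)}
    (hB : ∀ f ∈ B, ContDiff ℝ ∞ f) {k : Fin d}
    (hB' : ∀ f ∈ B, CoordSpan B (SegalBargmann.partialDeriv k f))
    {f : EuclideanSpace ℝ (Fin d) → ℂ} (hf : CoordSpan B f) :
    CoordSpan B (SegalBargmann.partialDeriv k f) := by
  have hdiff : ∀ {g}, CoordSpan B g → Differentiable ℝ g := fun hg =>
    (hg.contDiff hB).differentiable (by simp)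
  induction hf with
  | base hf => exact hB' _ hf
  | coord j hg ih =>
    rw [partialDeriv_coord_mul (hdiff hg)]
    by_cases h : j = k
    · simpa only [if_pos h] using (ih.coord j).add hg
    · simpa only [if_neg h, add_zero] using ih.coord j
  | add hf hg ih ih' =>
    rw [partialDeriv_add (hdiff hf) (hdiff hg)]
    exact ih.add ih'
  | sub hf hg ih ih' =>
    rw [partialDeriv_sub (hdiff hf) (hdiff hg)]
    exact ih.sub ih'

lemma CoordSpan.multiDeriv {B : Set (EuclideanSpace ℝ (Fin d) → ℂ)}
    (hB : ∀ f ∈ B, ContDiff ℝ ∞ f)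
    (hB' : ∀ f ∈ B, ∀ k, CoordSpan B (SegalBargmann.partialDeriv k f))
    {f : EuclideanSpace ℝ (Fin d) → ℂ} (hf : CoordSpan B f) (β : Fin d → ℕ) :
    CoordSpan B (SegalBargmann.multiDeriv β f) := by
  unfold SegalBargmann.multiDeriv
  induction List.finRange d with
  | nil => exact hf
  | cons a l ih =>
    simp only [List.foldr_cons]
    induction β a with
    | zero => exact ih
    | succ n ihn =>
      rw [Function.iterate_succ_apply']
      exact ihn.partialDeriv hB fun g hg => hB' g hg a

/-! ### Points of `ℂ^d` and the contour shift. -/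

@[simp]
lemma complexPoint_apply (x y : EuclideanSpace ℝ (Fin d)) (j : Fin d) :
    complexPoint x y j = (x j : ℂ) + Complex.I * (y j : ℂ) := rfl

@[fun_prop]
lemma continuous_complexPoint {X : Type*} [TopologicalSpace X]
    {f g : X → EuclideanSpace ℝ (Fin d)} (hf : Continuous f) (hg : Continuous g) :
    Continuous fun t => complexPoint (f t) (g t) := by
  unfold complexPoint
  fun_prop

lemma exists_complexPoint_eq (z : EuclideanSpace ℂ (Fin d)) :
    ∃ x y : EuclideanSpace ℝ (Fin d), complexPoint x y = z := by
  refine ⟨WithLp.toLp 2 fun j => (z j).re, WithLp.toLp 2 fun j => (z j).im, ?_⟩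
  ext j
  simp [mul_comm Complex.I, Complex.re_add_im]

lemma smul_complexPoint_add (c : ℂ) (u v : EuclideanSpace ℝ (Fin d)) :
    c • complexPoint u 0 + complexPoint 0 v = complexPoint (c.re • u) (v + c.im • u) := by
  ext j
  simp only [PiLp.add_apply, PiLp.smul_apply, complexPoint_apply, smul_eq_mul, PiLp.zero_apply]
  push_cast
  conv_lhs => rw [← Complex.re_add_im c]
  ring

lemma one_add_norm_le_mul (a b : EuclideanSpace ℝ (Fin d)) {R : ℝ} (hb : ‖b‖ ≤ R) :
    1 + ‖a‖ ≤ (1 + ‖a + b‖) * (1 + R) := by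
  have h : ‖a‖ ≤ ‖a + b‖ + ‖b‖ := by simpa using norm_sub_le (a + b) b
  have := norm_nonneg b
  nlinarith [mul_nonneg (norm_nonneg (a + b)) (this.trans hb)]

lemma integrable_inv_one_add_norm_pow :
    Integrable fun v : EuclideanSpace ℝ (Fin d) => 1 / (1 + ‖v‖) ^ (d + 1) := by
  have h := integrable_one_add_norm (E := EuclideanSpace ℝ (Fin d)) (μ := volume)
    (r := ((d + 1 : ℕ) : ℝ)) (by simp)
  refine h.congr (Filter.Eventually.of_forall fun v => ?_)
  have : (0 : ℝ) ≤ 1 + ‖v‖ := by positivity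
  simp only [Real.rpow_neg this, Real.rpow_natCast, one_div]

/-- The integral of an entire function over `u + iℝ^d` does not depend on `u`, provided the
function decays in the imaginary directions, locally uniformly in the real ones. -/
theorem integral_complexPoint_eq {H : EuclideanSpace ℂ (Fin d) → ℂ} (hH : Differentiable ℂ H)
    (hb : ∀ R : ℝ, ∃ C : ℝ, ∀ u v : EuclideanSpace ℝ (Fin d), ‖u‖ ≤ R →
      ‖H (complexPoint u v)‖ ≤ C * (1 / (1 + ‖v‖) ^ (d + 1)))
    (u : EuclideanSpace ℝ (Fin d)) :
    ∫ v, H (complexPoint u v) = ∫ v, H (complexPoint 0 v) := by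
  -- A complex parameter `c` joins the two contours: `c = 0` is `iℝ^d` and `c = 1` is `u + iℝ^d`.
  let K : ℂ → EuclideanSpace ℝ (Fin d) → ℂ := fun c v =>
    H (c • complexPoint u 0 + complexPoint 0 v)
  have hK : ∀ c v, K c v = H (complexPoint (c.re • u) (v + c.im • u)) := fun c v => by
    simp only [K, smul_complexPoint_add]
  have hHc : Continuous H := hH.continuous
  have hKd : ∀ v, Differentiable ℂ fun c => K c v := fun v =>
    hH.comp ((differentiable_id.smul_const _).add_const _)
  have hKc : Continuous (Function.uncurry fun v c => K c v) := by
    simp only [K, Function.uncurry_def]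
    fun_prop
  -- Radius 2 leaves room for Cauchy's estimate on unit circles centred in the unit ball about `c₀`,
  -- which dominates the derivative.
  have hKbound : ∀ c₀ : ℂ, ∃ C : ℝ, ∀ c ∈ Metric.closedBall c₀ 2, ∀ v,
      ‖K c v‖ ≤ C * (1 / (1 + ‖v‖) ^ (d + 1)) := by
    intro c₀
    obtain ⟨C, hC⟩ := hb ((‖c₀‖ + 2) * ‖u‖)
    refine ⟨|C| * (1 + (‖c₀‖ + 2) * ‖u‖) ^ (d + 1), fun c hc v => ?_⟩
    have hcn : ‖c‖ ≤ ‖c₀‖ + 2 := by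
      have := norm_sub_norm_le c c₀
      rw [mem_closedBall_iff_norm] at hc
      linarith
    have hre : ‖c.re • u‖ ≤ (‖c₀‖ + 2) * ‖u‖ := by
      rw [norm_smul, Real.norm_eq_abs]
      gcongr
      exact (Complex.abs_re_le_norm c).trans hcn
    have him : ‖c.im • u‖ ≤ (‖c₀‖ + 2) * ‖u‖ := by
      rw [norm_smul, Real.norm_eq_abs]
      gcongr
      exact (Complex.abs_im_le_norm c).trans hcn
    rw [hK]
    have h1 : (0 : ℝ) < 1 + ‖v‖ := by positivity
    have h2 : (0 : ℝ) < 1 + ‖v + c.im • u‖ := by positivity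
    calc _ ≤ C * (1 / (1 + ‖v + c.im • u‖) ^ (d + 1)) := hC _ _ hre
      _ ≤ |C| * (1 / (1 + ‖v + c.im • u‖) ^ (d + 1)) := by gcongr; exact le_abs_self C
      _ ≤ |C| * ((1 + (‖c₀‖ + 2) * ‖u‖) ^ (d + 1) * (1 / (1 + ‖v‖) ^ (d + 1))) := by
        gcongr
        rw [mul_one_div, div_le_div_iff₀ (by positivity) (by positivity), one_mul, ← mul_pow,
          mul_comm]
        gcongr
        exact one_add_norm_le_mul v _ him
      _ = _ := by ring
  have hderiv : ∀ c₀, HasDerivAt (fun c => ∫ v, K c v) (∫ v, deriv (fun c => K c v) c₀) c₀ := by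
    intro c₀
    obtain ⟨C, hC⟩ := hKbound c₀
    have hmeas : ∀ c, AEStronglyMeasurable (K c) volume := fun c => by
      have : Continuous (K c) := by simp only [K]; fun_prop
      exact this.aestronglyMeasurable
    refine (hasDerivAt_integral_of_dominated_loc_of_deriv_le
      (F' := fun c v => deriv (fun c => K c v) c)
      (bound := fun v => C * (1 / (1 + ‖v‖) ^ (d + 1)))
      (Metric.ball_mem_nhds c₀ one_pos) (Filter.Eventually.of_forall hmeas) ?_ ?_ ?_ ?_ ?_).2
    · exact (integrable_inv_one_add_norm_pow.const_mul C).mono' (hmeas _)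
        (Filter.Eventually.of_forall (hC c₀ (Metric.mem_closedBall_self (by norm_num))))
    · exact ((measurable_deriv_with_param hKc).comp
        (measurable_id.prodMk measurable_const)).aestronglyMeasurable
    · refine Filter.Eventually.of_forall fun v c hc => ?_
      have := Complex.norm_deriv_le_of_forall_mem_sphere_norm_le (c := c) one_pos
        (hKd v).diffContOnCl (C := C * (1 / (1 + ‖v‖) ^ (d + 1))) fun w hw => hC w ?_ v
      · simpa using this
      · rw [Metric.mem_closedBall]
        rw [Metric.mem_sphere] at hw
        rw [Metric.mem_ball] at hc
        linarith [dist_triangle w c c₀]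
    · exact integrable_inv_one_add_norm_pow.const_mul C
    · exact Filter.Eventually.of_forall fun v c _ => (hKd v c).hasDerivAt
  -- The imaginary part of `c` only translates `v`. The integral is thus holomorphic in `c` and
  -- constant on vertical lines, hence constant.
  have hre : ∀ c : ℂ, ∫ v, K c v = ∫ v, K c.re v := by
    intro c
    simp only [hK, Complex.ofReal_re, Complex.ofReal_im, zero_smul, add_zero]
    exact integral_add_right_eq_self (fun v => H (complexPoint (c.re • u) v)) (c.im • u)
  have hzero : ∀ c₀, deriv (fun c => ∫ v, K c v) c₀ = 0 := by
    intro c₀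
    have h1 : HasDerivAt (fun t : ℝ => c₀ + (t : ℂ) * Complex.I) Complex.I 0 := by
      simpa using ((Complex.ofRealCLM.hasDerivAt (x := (0 : ℝ))).mul_const Complex.I).const_add c₀
    have h2 := (show HasDerivAt (fun c => ∫ v, K c v) _ (c₀ + ((0 : ℝ) : ℂ) * Complex.I) by
      simpa using hderiv c₀).comp (0 : ℝ) h1
    have h3 : ((fun c => ∫ v, K c v) ∘ fun t : ℝ => c₀ + (t : ℂ) * Complex.I) =
        fun _ => ∫ v, K c₀.re v := by
      funext t
      simp only [Function.comp_apply]
      rw [hre]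
      simp
    rw [h3] at h2
    have h4 := h2.unique (hasDerivAt_const _ _)
    rw [(hderiv c₀).deriv]
    simpa using h4
  have := is_const_of_deriv_eq_zero (fun c => (hderiv c).differentiableAt) hzero 1 0
  simpa [hK] using this

/-! ### The growth condition and the inversion formula. -/

/-- Entire functions satisfying the growth condition that characterizes the transforms of
Schwartz-type functions. -/
def RapidBound (p : ℝ) (G : EuclideanSpace ℂ (Fin d) → ℂ) : Prop :=
  Differentiable ℂ G ∧
    ∀ n : ℕ, ∃ C : ℝ, ∀ x y : EuclideanSpace ℝ (Fin d),
      ‖G (complexPoint x y)‖ ≤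
        C * Real.exp (‖y‖ ^ 2 / 2) * Real.exp (‖x‖ ^ 2 / (2 * (p - 1))) *
          (1 / ((1 + ‖x‖) ^ n * (1 + ‖y‖) ^ n))

lemma norm_complexPoint_apply_le (x y : EuclideanSpace ℝ (Fin d)) (j : Fin d) :
    ‖complexPoint x y j‖ ≤ (1 + ‖x‖) * (1 + ‖y‖) := by
  have hx := PiLp.norm_apply_le x j
  have hy := PiLp.norm_apply_le y j
  calc ‖complexPoint x y j‖ ≤ ‖x j‖ + ‖y j‖ := by
        simpa using norm_add_le (x j : ℂ) (Complex.I * (y j : ℂ))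
    _ ≤ ‖x‖ + ‖y‖ := add_le_add hx hy
    _ ≤ _ := by nlinarith [mul_nonneg (norm_nonneg x) (norm_nonneg y)]

lemma RapidBound.coord_mul {p : ℝ} {G : EuclideanSpace ℂ (Fin d) → ℂ} (hG : RapidBound p G)
    (j : Fin d) : RapidBound p (fun z => z j * G z) := by
  refine ⟨(EuclideanSpace.proj (𝕜 := ℂ) j).differentiable.mul hG.1, fun n => ?_⟩
  obtain ⟨C, hC⟩ := hG.2 (n + 1)
  refine ⟨C, fun x y => ?_⟩
  have hx : 0 < 1 + ‖x‖ := by positivity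
  have hy : 0 < 1 + ‖y‖ := by positivity
  rw [norm_mul]
  calc _ ≤ ((1 + ‖x‖) * (1 + ‖y‖)) * (C * Real.exp (‖y‖ ^ 2 / 2) *
        Real.exp (‖x‖ ^ 2 / (2 * (p - 1))) * (1 / ((1 + ‖x‖) ^ (n + 1) * (1 + ‖y‖) ^ (n + 1)))) :=
      mul_le_mul (norm_complexPoint_apply_le x y j) (hC x y) (norm_nonneg _) (by positivity)
    _ = _ := by
      rw [pow_succ, pow_succ]
      field_simp
      ring

/-- The restriction of `G` to `u + iℝ^d`, with the Gaussian weight `e^{-v²/2}`. -/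
def slice (G : EuclideanSpace ℂ (Fin d) → ℂ) (u v : EuclideanSpace ℝ (Fin d)) : ℂ :=
  G (complexPoint u v) * (Real.exp (-‖v‖ ^ 2 / 2) : ℂ)

/-- The inversion formula for the Segal-Bargmann transform. -/
def inverseTransform (G : EuclideanSpace ℂ (Fin d) → ℂ) (x : EuclideanSpace ℝ (Fin d)) : ℂ :=
  (((2 * Real.pi) ^ (-(d : ℝ) / 2) : ℝ) : ℂ) *
    ((Real.exp (‖x‖ ^ 2 / 2) : ℂ) * 𝓕 (slice G 0) ((2 * Real.pi)⁻¹ • x))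

lemma continuous_slice {G : EuclideanSpace ℂ (Fin d) → ℂ} (hG : Continuous G)
    (u : EuclideanSpace ℝ (Fin d)) : Continuous (slice G u) := by
  unfold slice
  fun_prop

lemma RapidBound.norm_slice_le {p : ℝ} {G : EuclideanSpace ℂ (Fin d) → ℂ} (hG : RapidBound p G)
    (n : ℕ) : ∃ C : ℝ, 0 ≤ C ∧ ∀ u v : EuclideanSpace ℝ (Fin d),
      ‖slice G u v‖ ≤ C * Real.exp (‖u‖ ^ 2 / (2 * (p - 1))) *
        (1 / (1 + ‖u‖) ^ n) * (1 / (1 + ‖v‖) ^ n) := by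
  obtain ⟨C, hC⟩ := hG.2 n
  refine ⟨|C|, abs_nonneg C, fun u v => ?_⟩
  have he : Real.exp (‖v‖ ^ 2 / 2) * Real.exp (-‖v‖ ^ 2 / 2) = 1 := by
    rw [← Real.exp_add, ← Real.exp_zero]; congr 1; ring
  rw [slice, norm_mul, Complex.norm_real, Real.norm_eq_abs, Real.abs_exp]
  calc _ ≤ (|C| * Real.exp (‖v‖ ^ 2 / 2) * Real.exp (‖u‖ ^ 2 / (2 * (p - 1))) *
          (1 / ((1 + ‖u‖) ^ n * (1 + ‖v‖) ^ n))) * Real.exp (-‖v‖ ^ 2 / 2) := by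
        gcongr
        refine (hC u v).trans ?_
        gcongr
        exact le_abs_self C
    _ = (Real.exp (‖v‖ ^ 2 / 2) * Real.exp (-‖v‖ ^ 2 / 2)) * (|C| *
          Real.exp (‖u‖ ^ 2 / (2 * (p - 1))) * (1 / (1 + ‖u‖) ^ n) * (1 / (1 + ‖v‖) ^ n)) := by
        field_simp
    _ = _ := by rw [he, one_mul]

lemma RapidBound.integrable_pow_mul_slice {p : ℝ} {G : EuclideanSpace ℂ (Fin d) → ℂ}
    (hG : RapidBound p G) (u : EuclideanSpace ℝ (Fin d)) (n : ℕ) :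
    Integrable fun v => ‖v‖ ^ n * ‖slice G u v‖ := by
  -- The surplus `d + 1` powers make the bound integrable on `ℝ^d`.
  obtain ⟨C, hC0, hC⟩ := hG.norm_slice_le (n + (d + 1))
  have hcont := continuous_slice hG.1.continuous u
  refine (integrable_inv_one_add_norm_pow.const_mul
    (C * Real.exp (‖u‖ ^ 2 / (2 * (p - 1))) * (1 / (1 + ‖u‖) ^ (n + (d + 1))))).mono'
    (by fun_prop) (Filter.Eventually.of_forall fun v => ?_)
  have hv : 0 < 1 + ‖v‖ := by positivity
  rw [norm_mul, norm_norm, norm_pow, norm_norm]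
  calc _ ≤ (1 + ‖v‖) ^ n * (C * Real.exp (‖u‖ ^ 2 / (2 * (p - 1))) *
        (1 / (1 + ‖u‖) ^ (n + (d + 1))) * (1 / (1 + ‖v‖) ^ (n + (d + 1)))) := by
        gcongr
        · linarith
        · exact hC u v
    _ = _ := by
        rw [pow_add (1 + ‖v‖) n]
        field_simp

lemma RapidBound.integrable_slice {p : ℝ} {G : EuclideanSpace ℂ (Fin d) → ℂ}
    (hG : RapidBound p G) (u : EuclideanSpace ℝ (Fin d)) : Integrable (slice G u) := by
  have h := hG.integrable_pow_mul_slice u 0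
  simp only [pow_zero, one_mul] at h
  exact (integrable_norm_iff (continuous_slice hG.1.continuous u).aestronglyMeasurable).1 h

lemma sum_complexPoint_sub_sq (x u v : EuclideanSpace ℝ (Fin d)) :
    (∑ j, (complexPoint u v j - (x j : ℂ)) ^ 2) / 2 =
      (‖x - u‖ ^ 2 / 2 : ℝ) + (-‖v‖ ^ 2 / 2 : ℝ) - Complex.I * (inner ℝ v (x - u) : ℝ) := by
  rw [EuclideanSpace.real_norm_sq_eq, EuclideanSpace.real_norm_sq_eq, PiLp.inner_apply]
  push_cast
  rw [neg_div, Finset.mul_sum, Finset.sum_div, Finset.sum_div, Finset.sum_div,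
    ← Finset.sum_neg_distrib, ← Finset.sum_add_distrib, ← Finset.sum_sub_distrib]
  refine Finset.sum_congr rfl fun j _ => ?_
  simp only [complexPoint_apply, PiLp.sub_apply, RCLike.inner_apply, conj_trivial]
  push_cast
  linear_combination (v j : ℂ) ^ 2 / 2 * Complex.I_sq

/-- With `z = u + iv`, the exponent `(z-x)²/2` contains both Gaussians and the Fourier phase. The
integrand becomes entire in `z`, as the contour shift requires. -/
lemma fourier_slice (G : EuclideanSpace ℂ (Fin d) → ℂ) (x u : EuclideanSpace ℝ (Fin d)) :
    (Real.exp (‖x - u‖ ^ 2 / 2) : ℂ) * 𝓕 (slice G u) ((2 * Real.pi)⁻¹ • (x - u)) =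
      ∫ v, G (complexPoint u v) *
        Complex.exp ((∑ j, (complexPoint u v j - (x j : ℂ)) ^ 2) / 2) := by
  rw [Real.fourier_eq', ← integral_const_mul]
  refine integral_congr_ae (Filter.Eventually.of_forall fun v => ?_)
  simp only [slice, smul_eq_mul, inner_smul_right, sum_complexPoint_sub_sq]
  rw [sub_eq_add_neg _ (Complex.I * _), Complex.exp_add, Complex.exp_add, Complex.ofReal_exp,
    Complex.ofReal_exp]
  have : ((-2 * Real.pi * ((2 * Real.pi)⁻¹ * inner ℝ v (x - u)) : ℝ) : ℂ) * Complex.I =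
      -(Complex.I * (inner ℝ v (x - u) : ℝ)) := by
    have hpi : Real.pi ≠ 0 := Real.pi_ne_zero
    rw [show -2 * Real.pi * ((2 * Real.pi)⁻¹ * inner ℝ v (x - u)) = -inner ℝ v (x - u) by
      field_simp]
    push_cast
    ring
  rw [this]
  ring

lemma differentiable_mul_exp_sum {G : EuclideanSpace ℂ (Fin d) → ℂ} (hG : Differentiable ℂ G)
    (x : EuclideanSpace ℝ (Fin d)) :
    Differentiable ℂ fun z => G z * Complex.exp ((∑ j, (z j - (x j : ℂ)) ^ 2) / 2) := by
  refine hG.mul (Differentiable.cexp ?_)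
  simp only [div_eq_mul_inv]
  refine (Differentiable.fun_sum fun j _ => ?_).mul_const _
  exact (((EuclideanSpace.proj (𝕜 := ℂ) j).differentiable).sub_const _).pow 2

lemma norm_mul_exp_sum (G : EuclideanSpace ℂ (Fin d) → ℂ) (x u v : EuclideanSpace ℝ (Fin d)) :
    ‖G (complexPoint u v) * Complex.exp ((∑ j, (complexPoint u v j - (x j : ℂ)) ^ 2) / 2)‖ =
      Real.exp (‖x - u‖ ^ 2 / 2) * ‖slice G u v‖ := by
  rw [sum_complexPoint_sub_sq, slice, norm_mul, norm_mul, Complex.norm_exp, Complex.norm_real,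
    Real.norm_eq_abs, Real.abs_exp, mul_left_comm, ← Real.exp_add]
  simp only [Complex.sub_re, Complex.add_re, Complex.ofReal_re, Complex.I_mul_re,
    Complex.ofReal_im, neg_zero, sub_zero]

/-- In the inversion formula the integral may be taken over any `u + iℝ^d`. -/
theorem RapidBound.inverseTransform_eq {p : ℝ} (hp : 1 < p) {G : EuclideanSpace ℂ (Fin d) → ℂ}
    (hG : RapidBound p G) (u x : EuclideanSpace ℝ (Fin d)) :
    inverseTransform G x = (((2 * Real.pi) ^ (-(d : ℝ) / 2) : ℝ) : ℂ) *
      ((Real.exp (‖x - u‖ ^ 2 / 2) : ℂ) * 𝓕 (slice G u) ((2 * Real.pi)⁻¹ • (x - u))) := by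
  have h0 := fourier_slice G x 0
  rw [sub_zero] at h0
  rw [inverseTransform, h0, fourier_slice]
  congr 1
  refine (integral_complexPoint_eq (differentiable_mul_exp_sum hG.1 x) (fun R => ?_) u).symm
  obtain ⟨C, hC0, hC⟩ := hG.norm_slice_le (d + 1)
  refine ⟨Real.exp ((‖x‖ + R) ^ 2 / 2) * (C * Real.exp (R ^ 2 / (2 * (p - 1)))), fun u v hu => ?_⟩
  have hp' : 0 < p - 1 := by linarith
  rw [norm_mul_exp_sum, mul_assoc]
  have hxu : ‖x - u‖ ≤ ‖x‖ + R := (norm_sub_le x u).trans (by gcongr)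
  gcongr
  refine (hC u v).trans (mul_le_mul_of_nonneg_right ?_ (by positivity))
  calc C * Real.exp (‖u‖ ^ 2 / (2 * (p - 1))) * (1 / (1 + ‖u‖) ^ (d + 1))
      ≤ C * Real.exp (‖u‖ ^ 2 / (2 * (p - 1))) * 1 := by
        gcongr
        exact div_le_one_of_le₀ (one_le_pow₀ (by linarith [norm_nonneg u])) (by positivity)
    _ ≤ _ := by
        rw [mul_one]
        gcongr

/-! ### Rapid decay and the Gaussian measure. -/

lemma integrable_exp_neg_mul_sq_add_inner {b : ℝ} (hb : 0 < b) (w : EuclideanSpace ℝ (Fin d)) :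
    Integrable fun v : EuclideanSpace ℝ (Fin d) =>
      Real.exp (-b * ‖v‖ ^ 2 + inner ℝ w v) := by
  have h := (GaussianFourier.integrable_cexp_neg_mul_sq_norm_add (V := EuclideanSpace ℝ (Fin d))
    (b := (b : ℂ)) (by simpa using hb) 1 w).norm
  refine h.congr (Filter.Eventually.of_forall fun v => ?_)
  simp only [Complex.norm_exp]
  congr 1
  simp [← Complex.ofReal_pow]

/-- Rapid decay relative to `e^{x²/(2p)}`. -/
def RapidDecay (p : ℝ) (f : EuclideanSpace ℝ (Fin d) → ℂ) : Prop :=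
  ∀ n : ℕ, ∃ C : ℝ, 0 ≤ C ∧ ∀ x : EuclideanSpace ℝ (Fin d),
    ‖f x‖ ≤ C * Real.exp (‖x‖ ^ 2 / (2 * p)) * (1 / (1 + ‖x‖) ^ n)

lemma RapidDecay.of_mul_pow {p : ℝ} {f g : EuclideanSpace ℝ (Fin d) → ℂ} (hf : RapidDecay p f)
    {m : ℕ} (h : ∀ x, ‖g x‖ ≤ (1 + ‖x‖) ^ m * ‖f x‖) : RapidDecay p g := by
  intro n
  obtain ⟨C, hC0, hC⟩ := hf (n + m)
  refine ⟨C, hC0, fun x => (h x).trans ?_⟩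
  have hx : 0 < 1 + ‖x‖ := by positivity
  calc _ ≤ (1 + ‖x‖) ^ m * (C * Real.exp (‖x‖ ^ 2 / (2 * p)) * (1 / (1 + ‖x‖) ^ (n + m))) := by
        gcongr
        exact hC x
    _ = _ := by
        rw [pow_add]
        field_simp

lemma RapidDecay.of_norm_le_add {p : ℝ} {f g h : EuclideanSpace ℝ (Fin d) → ℂ}
    (hf : RapidDecay p f) (hg : RapidDecay p g) (hh : ∀ x, ‖h x‖ ≤ ‖f x‖ + ‖g x‖) :
    RapidDecay p h := by
  intro n
  obtain ⟨C, hC0, hC⟩ := hf n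
  obtain ⟨D, hD0, hD⟩ := hg n
  refine ⟨C + D, by positivity, fun x => ?_⟩
  have := hC x
  have := hD x
  have := hh x
  rw [add_mul, add_mul]
  linarith

lemma RapidDecay.monomial_mul {p : ℝ} {f : EuclideanSpace ℝ (Fin d) → ℂ} (hf : RapidDecay p f)
    (α : Fin d → ℕ) : RapidDecay p fun x => (monomial α x : ℂ) * f x := by
  refine hf.of_mul_pow (m := ∑ j, α j) fun x => ?_
  rw [norm_mul, Complex.norm_real, monomial, norm_prod, ← Finset.prod_pow_eq_pow_sum]
  refine mul_le_mul_of_nonneg_right ?_ (norm_nonneg _)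
  refine Finset.prod_le_prod (fun j _ => norm_nonneg _) fun j _ => ?_
  rw [norm_pow]
  gcongr
  linarith [PiLp.norm_apply_le x j]

lemma CoordSpan.rapidDecay {p : ℝ} {B : Set (EuclideanSpace ℝ (Fin d) → ℂ)}
    (hB : ∀ f ∈ B, RapidDecay p f) {f : EuclideanSpace ℝ (Fin d) → ℂ} (hf : CoordSpan B f) :
    RapidDecay p f := by
  induction hf with
  | base hf => exact hB _ hf
  | coord j _ ih =>
    refine ih.of_mul_pow (m := 1) fun x => ?_
    rw [norm_mul, Complex.norm_real, pow_one]
    gcongr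
    linarith [PiLp.norm_apply_le x j]
  | add _ _ ih ih' => exact ih.of_norm_le_add ih' fun x => norm_add_le _ _
  | sub _ _ ih ih' => exact ih.of_norm_le_add ih' fun x => norm_sub_le _ _

lemma rho_eq (x : EuclideanSpace ℝ (Fin d)) :
    rho d x = (2 * Real.pi) ^ (-(d : ℝ) / 2) * Real.exp (-‖x‖ ^ 2 / 2) := by
  rw [rho, EuclideanSpace.real_norm_sq_eq]

lemma rho_pos (x : EuclideanSpace ℝ (Fin d)) : 0 < rho d x := by
  unfold rho
  positivity

lemma continuous_rho : Continuous (rho d) := by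
  unfold rho
  fun_prop

lemma integrable_gaussianMeasure_iff {E : Type*} [NormedAddCommGroup E] [NormedSpace ℝ E]
    {g : EuclideanSpace ℝ (Fin d) → E} :
    Integrable g (gaussianMeasure d) ↔ Integrable fun x => rho d x • g x := by
  rw [gaussianMeasure, integrable_withDensity_iff_integrable_smul'
    (continuous_rho.measurable.ennreal_ofReal) (by simp)]
  simp only [ENNReal.toReal_ofReal (rho_pos _).le]

lemma integral_gaussianMeasure {E : Type*} [NormedAddCommGroup E] [NormedSpace ℝ E]
    (g : EuclideanSpace ℝ (Fin d) → E) :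
    ∫ x, g x ∂gaussianMeasure d = ∫ x, rho d x • g x := by
  rw [gaussianMeasure, integral_withDensity_eq_integral_toReal_smul
    (continuous_rho.measurable.ennreal_ofReal) (by simp)]
  simp only [ENNReal.toReal_ofReal (rho_pos _).le]

/-- The `p`-th power of `e^{x²/(2p)}` cancels the Gaussian density exactly, so integrability comes
from the polynomial factor alone. -/
lemma RapidDecay.memLp {p : ℝ} (hp : 1 < p) {f : EuclideanSpace ℝ (Fin d) → ℂ}
    (hf : RapidDecay p f) (hfc : Continuous f) :
    MemLp f (ENNReal.ofReal p) (gaussianMeasure d) := by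
  have hp0 : 0 < p := by linarith
  rw [← integrable_norm_rpow_iff hfc.aestronglyMeasurable (by simpa using hp0)
    ENNReal.ofReal_ne_top, ENNReal.toReal_ofReal hp0.le, integrable_gaussianMeasure_iff]
  obtain ⟨C, hC0, hC⟩ := hf (d + 1)
  refine (integrable_inv_one_add_norm_pow.const_mul
    ((2 * Real.pi) ^ (-(d : ℝ) / 2) * C ^ p)).mono' ?_ (Filter.Eventually.of_forall fun x => ?_)
  · have : Continuous fun x => ‖f x‖ ^ p := hfc.norm.rpow_const fun _ => Or.inr hp0.le
    exact (continuous_rho.smul this).aestronglyMeasurable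
  have hx : 1 ≤ (1 + ‖x‖) ^ (d + 1) := one_le_pow₀ (by linarith [norm_nonneg x])
  have hx0 : 0 < (1 + ‖x‖) ^ (d + 1) := by positivity
  rw [norm_smul, Real.norm_of_nonneg (rho_pos x).le, Real.norm_of_nonneg (by positivity)]
  calc _ ≤ rho d x * (C * Real.exp (‖x‖ ^ 2 / (2 * p)) * (1 / (1 + ‖x‖) ^ (d + 1))) ^ p := by
        have := rho_pos x
        gcongr
        exact hC x
    _ = (2 * Real.pi) ^ (-(d : ℝ) / 2) * C ^ p * (1 / (1 + ‖x‖) ^ (d + 1)) ^ p := by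
        rw [Real.mul_rpow (by positivity) (by positivity), Real.mul_rpow hC0 (by positivity),
          ← Real.exp_mul, rho_eq]
        have : Real.exp (-‖x‖ ^ 2 / 2) * Real.exp (‖x‖ ^ 2 / (2 * p) * p) = 1 := by
          rw [← Real.exp_add, ← Real.exp_zero]
          congr 1
          field_simp
          ring
        linear_combination ((2 * Real.pi) ^ (-(d : ℝ) / 2) * C ^ p *
          (1 / (1 + ‖x‖) ^ (d + 1)) ^ p) * this
    _ ≤ _ := by
        gcongr
        have := Real.rpow_le_rpow_of_exponent_ge (x := 1 / (1 + ‖x‖) ^ (d + 1)) (by positivity)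
          (div_le_one_of_le₀ hx hx0.le) hp.le
        rwa [Real.rpow_one] at this

/-! ### Smoothness, derivatives and decay of the inverse transform. -/

lemma RapidBound.contDiff_inverseTransform {p : ℝ} {G : EuclideanSpace ℂ (Fin d) → ℂ}
    (hG : RapidBound p G) : ContDiff ℝ ∞ (inverseTransform G) := by
  unfold inverseTransform
  refine contDiff_const.mul (ContDiff.mul ?_ ?_)
  · exact Complex.ofRealCLM.contDiff.comp (((contDiff_norm_sq ℝ).div_const 2).exp)
  · exact (Real.contDiff_fourier (N := ⊤) fun n _ => hG.integrable_pow_mul_slice 0 n).comp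
      (contDiff_const_smul _)

/-- Formally, differentiating `e^{(z-x)²/2}` in `x_k` brings down `x_k - z_k`. -/
lemma RapidBound.partialDeriv_inverseTransform {p : ℝ} {G : EuclideanSpace ℂ (Fin d) → ℂ}
    (hG : RapidBound p G) (k : Fin d) :
    partialDeriv k (inverseTransform G) = fun x => (x k : ℂ) * inverseTransform G x -
      inverseTransform (fun z => z k * G z) x := by
  have hInt := hG.integrable_slice 0
  have hInt1 : Integrable fun v => ‖v‖ * ‖slice G 0 v‖ := by
    simpa using hG.integrable_pow_mul_slice 0 1
  have hInt2 : Integrable (VectorFourier.fourierSMulRight (innerSL ℝ) (slice G 0)) := by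
    refine (hInt1.const_mul (2 * Real.pi * ‖innerSL (E := EuclideanSpace ℝ (Fin d)) ℝ‖)).mono'
      hInt.1.fourierSMulRight (Filter.Eventually.of_forall fun v => ?_)
    exact (VectorFourier.norm_fourierSMulRight_le _ _ v).trans (by rw [mul_assoc _ ‖v‖])
  rw [partialDeriv_eq_fderiv (hG.contDiff_inverseTransform.differentiable (by simp))]
  funext x
  set e : EuclideanSpace ℝ (Fin d) := EuclideanSpace.single k 1
  set w := (2 * Real.pi)⁻¹ • x
  have hF : HasFDerivAt (fun x => 𝓕 (slice G 0) ((2 * Real.pi)⁻¹ • x)) _ x :=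
    (Real.hasFDerivAt_fourier hInt hInt1 w).comp x
      ((hasFDerivAt_id x).const_smul ((2 * Real.pi)⁻¹))
  have hE : HasFDerivAt (fun x : EuclideanSpace ℝ (Fin d) => (Real.exp (‖x‖ ^ 2 / 2) : ℂ)) _ x :=
    Complex.ofRealCLM.hasFDerivAt.comp x
      (((hasStrictFDerivAt_norm_sq x).hasFDerivAt.mul_const (2⁻¹ : ℝ)).exp)
  -- On `iℝ^d` the coordinate `z_k` is `i v_k`, and the rescaling of `x` removes the `2π` from the
  -- factor `-2πi v_k`.
  have hfour : 𝓕 (VectorFourier.fourierSMulRight (innerSL ℝ) (slice G 0)) w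
      ((2 * Real.pi)⁻¹ • e) = -𝓕 (slice (fun z => z k * G z) 0) w := by
    rw [Real.fourier_continuousLinearMap_apply hInt2, Real.fourier_eq', Real.fourier_eq',
      ← integral_neg]
    refine integral_congr_ae (Filter.Eventually.of_forall fun v => ?_)
    have hpi : (Real.pi : ℂ) ≠ 0 := by exact_mod_cast Real.pi_ne_zero
    have hin : innerSL ℝ v (EuclideanSpace.single k 1) = v k := by
      rw [innerSL_apply_apply]
      simp [EuclideanSpace.inner_single_right]
    simp [slice, e]
    field_simp
    rw [hin, mul_comm]
  have hfull := (hE.mul hF).const_mul (((2 * Real.pi) ^ (-(d : ℝ) / 2) : ℝ) : ℂ)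
  have : fderiv ℝ (inverseTransform G) x = _ := hfull.fderiv
  rw [this]
  have hcomp : (𝓕 (VectorFourier.fourierSMulRight (innerSL ℝ) (slice G 0)) w ∘SL
      ((2 * Real.pi)⁻¹ • ContinuousLinearMap.id ℝ (EuclideanSpace ℝ (Fin d)))) e =
      -𝓕 (slice (fun z => z k * G z) 0) w := hfour
  rw [smul_apply, add_apply, smul_apply, smul_apply, hcomp]
  simp [inverseTransform, e, w, EuclideanSpace.inner_single_right]
  ring_nf

lemma RapidBound.rapidDecay_inverseTransform {p : ℝ} (hp : 1 < p)
    {G : EuclideanSpace ℂ (Fin d) → ℂ} (hG : RapidBound p G) :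
    RapidDecay p (inverseTransform G) := by
  intro n
  have hp0 : 0 < p := by linarith
  have hp1 : 0 < p - 1 := by linarith
  obtain ⟨C, hC0, hC⟩ := hG.norm_slice_le (n + (d + 1))
  set J : ℝ := ∫ v : EuclideanSpace ℝ (Fin d), 1 / (1 + ‖v‖) ^ (d + 1) with hJ
  have hJ0 : 0 ≤ J := integral_nonneg fun v => by positivity
  refine ⟨(2 * Real.pi) ^ (-(d : ℝ) / 2) * (C * (p / (p - 1)) ^ n * J), by positivity,
    fun x => ?_⟩
  -- This `u` minimizes `|x-u|²/2 + |u|²/(2(p-1))`; the minimum is `|x|²/(2p)`. Since `u` is a fixed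
  -- multiple of `x`, decay in `u` is decay in `x`.
  set u := ((p - 1) / p) • x with hu
  have hun : ‖u‖ = (p - 1) / p * ‖x‖ := by
    rw [hu, norm_smul, Real.norm_of_nonneg (by positivity)]
  have hxu : ‖x - u‖ = 1 / p * ‖x‖ := by
    have : x - u = (1 / p) • x := by
      nth_rewrite 1 [hu, ← one_smul ℝ x]
      rw [← sub_smul]
      congr 1
      field_simp
      ring
    rw [this, norm_smul, Real.norm_of_nonneg (by positivity)]
  have hux : 1 / (1 + ‖u‖) ^ n ≤ (p / (p - 1)) ^ n * (1 / (1 + ‖x‖) ^ n) := by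
    rw [mul_one_div, div_le_div_iff₀ (by positivity) (by positivity), one_mul, ← mul_pow]
    gcongr
    rw [hun, mul_add, mul_one]
    have h1 : 1 ≤ p / (p - 1) := by rw [le_div_iff₀ hp1]; linarith
    have h2 : p / (p - 1) * ((p - 1) / p * ‖x‖) = ‖x‖ := by field_simp
    rw [h2]
    gcongr
  have hexp : Real.exp (‖x - u‖ ^ 2 / 2) * Real.exp (‖u‖ ^ 2 / (2 * (p - 1))) =
      Real.exp (‖x‖ ^ 2 / (2 * p)) := by
    rw [← Real.exp_add, hxu, hun]
    congr 1
    field_simp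
    ring
  have hInt : ‖∫ v, G (complexPoint u v) *
        Complex.exp ((∑ j, (complexPoint u v j - (x j : ℂ)) ^ 2) / 2)‖ ≤
      Real.exp (‖x - u‖ ^ 2 / 2) * (C * Real.exp (‖u‖ ^ 2 / (2 * (p - 1))) *
        (1 / (1 + ‖u‖) ^ n)) * J := by
    rw [hJ, ← integral_const_mul]
    refine norm_integral_le_of_norm_le (integrable_inv_one_add_norm_pow.const_mul _)
      (Filter.Eventually.of_forall fun v => ?_)
    rw [norm_mul_exp_sum, mul_assoc (Real.exp _)]
    gcongr
    refine (hC u v).trans ?_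
    have h1 := one_div_pow_le_one_div_pow_of_le (a := 1 + ‖u‖) (by linarith [norm_nonneg u])
      (show n ≤ n + (d + 1) by omega)
    have h2 := one_div_pow_le_one_div_pow_of_le (a := 1 + ‖v‖) (by linarith [norm_nonneg v])
      (show d + 1 ≤ n + (d + 1) by omega)
    exact mul_le_mul (mul_le_mul_of_nonneg_left h1 (by positivity)) h2 (by positivity)
      (by positivity)
  rw [hG.inverseTransform_eq hp u x, fourier_slice, norm_mul, Complex.norm_real,
    Real.norm_of_nonneg (by positivity)]
  calc _ ≤ (2 * Real.pi) ^ (-(d : ℝ) / 2) * (Real.exp (‖x - u‖ ^ 2 / 2) *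
        (C * Real.exp (‖u‖ ^ 2 / (2 * (p - 1))) *
          ((p / (p - 1)) ^ n * (1 / (1 + ‖x‖) ^ n))) * J) := by
        refine mul_le_mul_of_nonneg_left (hInt.trans ?_) (by positivity)
        refine mul_le_mul_of_nonneg_right ?_ hJ0
        exact mul_le_mul_of_nonneg_left (mul_le_mul_of_nonneg_left hux (by positivity))
          (by positivity)
    _ = _ := by
        rw [← hexp]
        ring

/-! ### The transform undoes the inverse transform. -/

lemma rhoC_complexPoint_sub (u s x : EuclideanSpace ℝ (Fin d)) :
    rhoC d (complexPoint u s - complexPoint x 0) =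
      (((2 * Real.pi) ^ (-(d : ℝ) / 2) : ℝ) : ℂ) * ((Real.exp (-‖x - u‖ ^ 2 / 2) : ℂ) *
        (Real.exp (‖s‖ ^ 2 / 2) : ℂ) * Complex.exp (Complex.I * (inner ℝ s (x - u) : ℝ))) := by
  have h := sum_complexPoint_sub_sq x u s
  have h' : -(∑ j, (complexPoint u s - complexPoint x 0) j ^ 2) / 2 =
      ((-‖x - u‖ ^ 2 / 2 : ℝ) : ℂ) + (‖s‖ ^ 2 / 2 : ℝ) +
        Complex.I * (inner ℝ s (x - u) : ℝ) := by
    have h0 : ∑ j, (complexPoint u s - complexPoint x 0) j ^ 2 =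
        ∑ j, (complexPoint u s j - (x j : ℂ)) ^ 2 := by
      refine Finset.sum_congr rfl fun j _ => ?_
      simp
    rw [h0, neg_div, h]
    push_cast
    ring
  rw [rhoC, h', Complex.exp_add, Complex.exp_add, Complex.ofReal_exp, Complex.ofReal_exp]

lemma normalization_sq :
    ((2 * Real.pi) ^ (-(d : ℝ) / 2)) * ((2 * Real.pi) ^ (-(d : ℝ) / 2)) * (2 * Real.pi) ^ d = 1 := by
  have h : (0 : ℝ) < 2 * Real.pi := by positivity
  rw [← Real.rpow_natCast, ← Real.rpow_add h, ← Real.rpow_add h, ← Real.rpow_zero (2 * Real.pi)]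
  congr 1
  ring

/-- Dividing the bound `e^{|y+u|²/(2p)}` for the inverse transform by `e^{|y|²/2}` leaves a genuine
Gaussian, because `1/p < 1`. -/
lemma RapidBound.integrable_fourier_slice {p : ℝ} (hp : 1 < p)
    {G : EuclideanSpace ℂ (Fin d) → ℂ} (hG : RapidBound p G) (u : EuclideanSpace ℝ (Fin d)) :
    Integrable (𝓕 (slice G u)) := by
  have hp0 : 0 < p := by linarith
  have hpi : (0 : ℝ) < 2 * Real.pi := by positivity
  rw [← integrable_comp_smul_iff volume _ (inv_ne_zero hpi.ne')]
  obtain ⟨C, hC0, hC⟩ := hG.rapidDecay_inverseTransform hp 0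
  set c : ℝ := (2 * Real.pi) ^ (-(d : ℝ) / 2) with hc
  have hc0 : 0 < c := by positivity
  have hb : 0 < (1 - 1 / p) / 2 := by
    have : 1 / p < 1 := by rw [div_lt_one hp0]; exact hp
    linarith
  refine ((integrable_exp_neg_mul_sq_add_inner hb ((1 / p) • u)).const_mul
    (c⁻¹ * C * Real.exp (‖u‖ ^ 2 / (2 * p)))).mono' ?_ (Filter.Eventually.of_forall fun y => ?_)
  · have : ContDiff ℝ ∞ (𝓕 (slice G u)) :=
      Real.contDiff_fourier (N := ⊤) fun n _ => hG.integrable_pow_mul_slice u n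
    have := this.continuous
    exact Continuous.aestronglyMeasurable (by fun_prop)
  have h := hG.inverseTransform_eq hp u (y + u)
  rw [add_sub_cancel_right] at h
  have h1 := hC (y + u)
  rw [h, norm_mul, norm_mul, Complex.norm_real, Complex.norm_real, Real.norm_of_nonneg hc0.le,
    Real.norm_of_nonneg (Real.exp_nonneg _), pow_zero, div_one, mul_one] at h1
  have h2 : ‖𝓕 (slice G u) ((2 * Real.pi)⁻¹ • y)‖ ≤
      c⁻¹ * C * (Real.exp (-(‖y‖ ^ 2 / 2)) * Real.exp (‖y + u‖ ^ 2 / (2 * p))) := by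
    rw [Real.exp_neg]
    have he := Real.exp_pos (‖y‖ ^ 2 / 2)
    generalize ‖𝓕 (slice G u) ((2 * Real.pi)⁻¹ • y)‖ = A at h1
    field_simp
    linarith
  refine h2.trans (le_of_eq ?_)
  rw [← Real.exp_add, mul_assoc (c⁻¹ * C), ← Real.exp_add]
  congr 2
  rw [norm_add_sq_real, inner_smul_left, real_inner_comm u y]
  simp only [conj_trivial]
  field_simp
  ring

/-- To evaluate at `u + is`, the inverse transform is written on the slice through the same `u`. The
factors `e^{±|x-u|²/2}` cancel, and Fourier inversion at `s` remains. -/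
theorem RapidBound.transform_inverseTransform {p : ℝ} (hp : 1 < p)
    {G : EuclideanSpace ℂ (Fin d) → ℂ} (hG : RapidBound p G) :
    transform (inverseTransform G) = G := by
  funext z
  obtain ⟨u, s, rfl⟩ := exists_complexPoint_eq z
  have hpi : (0 : ℝ) < 2 * Real.pi := by positivity
  set c : ℝ := (2 * Real.pi) ^ (-(d : ℝ) / 2) with hc
  let Ψ : EuclideanSpace ℝ (Fin d) → ℂ := fun y =>
    Complex.exp ((2 * Real.pi * inner ℝ y s : ℝ) * Complex.I) • 𝓕 (slice G u) y
  have hpt : ∀ x, rhoC d (complexPoint u s - complexPoint x 0) * inverseTransform G x =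
      (c * c * Real.exp (‖s‖ ^ 2 / 2) : ℝ) * Ψ ((2 * Real.pi)⁻¹ • (x - u)) := by
    intro x
    rw [rhoC_complexPoint_sub, hG.inverseTransform_eq hp u x]
    have he : (Real.exp (-‖x - u‖ ^ 2 / 2) : ℂ) * (Real.exp (‖x - u‖ ^ 2 / 2) : ℂ) = 1 := by
      rw [← Complex.ofReal_mul, ← Real.exp_add, neg_div, neg_add_cancel, Real.exp_zero,
        Complex.ofReal_one]
    have hi : ((2 * Real.pi * inner ℝ ((2 * Real.pi)⁻¹ • (x - u)) s : ℝ) : ℂ) * Complex.I =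
        Complex.I * (inner ℝ s (x - u) : ℝ) := by
      rw [real_inner_smul_left, mul_inv_cancel_left₀ hpi.ne', real_inner_comm, mul_comm]
    simp only [Ψ, smul_eq_mul, hi]
    push_cast at he ⊢
    linear_combination ((c : ℂ) * c * Complex.exp (‖s‖ ^ 2 / 2) *
      Complex.exp (Complex.I * (inner ℝ s (x - u) : ℝ)) *
        𝓕 (slice G u) ((2 * Real.pi)⁻¹ • (x - u))) * he
  have hinv : ∫ y, Ψ y = slice G u s := by
    have h := (hG.integrable_slice u).fourierInv_fourier_eq (hG.integrable_fourier_slice hp u)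
      (continuous_slice hG.1.continuous u).continuousAt (v := s)
    rwa [Real.fourierInv_eq'] at h
  rw [transform]
  simp only [hpt]
  rw [integral_const_mul, integral_sub_right_eq_self (fun x => Ψ ((2 * Real.pi)⁻¹ • x)) u,
    Measure.integral_comp_inv_smul_of_nonneg volume Ψ hpi.le, hinv, finrank_euclideanSpace_fin,
    slice, Complex.real_smul]
  have he : Real.exp (‖s‖ ^ 2 / 2) * Real.exp (-‖s‖ ^ 2 / 2) = 1 := by
    rw [← Real.exp_add, neg_div, add_neg_cancel, Real.exp_zero]
  have hone : c * c * Real.exp (‖s‖ ^ 2 / 2) * ((2 * Real.pi) ^ d * Real.exp (-‖s‖ ^ 2 / 2)) =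
      1 := by
    have := normalization_sq (d := d)
    linear_combination (c * c * (2 * Real.pi) ^ d) * he + this
  have honeC := congrArg (Complex.ofReal) hone
  simp only [Complex.ofReal_mul, Complex.ofReal_one] at honeC ⊢
  linear_combination G (complexPoint u s) * honeC

theorem RapidBound.exists_preimage {p : ℝ} (hp : 1 < p) {F : EuclideanSpace ℂ (Fin d) → ℂ}
    (hF : RapidBound p F) :
    ∃ f : EuclideanSpace ℝ (Fin d) → ℂ,
      MemLp f (ENNReal.ofReal p) (gaussianMeasure d) ∧ transform f = F ∧ ContDiff ℝ ∞ f ∧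
      ∀ α β : Fin d → ℕ,
        MemLp (fun x => (monomial α x : ℂ) * multiDeriv β f x)
          (ENNReal.ofReal p) (gaussianMeasure d) := by
  -- Using all admissible `G` at once makes the coordinate span of `B` stable under differentiation.
  let B : Set (EuclideanSpace ℝ (Fin d) → ℂ) := {f | ∃ G, RapidBound p G ∧ inverseTransform G = f}
  have hsmooth : ∀ f ∈ B, ContDiff ℝ ∞ f := by
    rintro _ ⟨G, hG, rfl⟩
    exact hG.contDiff_inverseTransform
  have hdecay : ∀ f ∈ B, RapidDecay p f := by
    rintro _ ⟨G, hG, rfl⟩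
    exact hG.rapidDecay_inverseTransform hp
  have hderiv : ∀ f ∈ B, ∀ k, CoordSpan B (partialDeriv k f) := by
    rintro _ ⟨G, hG, rfl⟩ k
    rw [hG.partialDeriv_inverseTransform]
    have h1 : inverseTransform G ∈ B := ⟨G, hG, rfl⟩
    have h2 : inverseTransform (fun z => z k * G z) ∈ B := ⟨_, hG.coord_mul k, rfl⟩
    exact (CoordSpan.coord k (.base h1)).sub (.base h2)
  have hmem : inverseTransform F ∈ B := ⟨F, hF, rfl⟩
  refine ⟨inverseTransform F,
    (hdecay _ hmem).memLp hp (hsmooth _ hmem).continuous, hF.transform_inverseTransform hp,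
    hsmooth _ hmem, fun α β => ?_⟩
  have hspan := (CoordSpan.base hmem).multiDeriv hsmooth hderiv β
  have hcont : Continuous (multiDeriv β (inverseTransform F)) :=
    (hspan.contDiff hsmooth).continuous
  refine ((hspan.rapidDecay hdecay).monomial_mul α).memLp hp (Continuous.mul ?_ hcont)
  unfold monomial
  fun_prop

/-! ### The pointwise bound from Hölder's inequality. -/

lemma norm_rhoC_complexPoint_sub (u s x : EuclideanSpace ℝ (Fin d)) :
    ‖rhoC d (complexPoint u s - complexPoint x 0)‖ =
      Real.exp (‖s‖ ^ 2 / 2) * Real.exp (-‖u‖ ^ 2 / 2) * (rho d x * Real.exp (inner ℝ u x)) := by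
  have h : Real.exp (-‖x - u‖ ^ 2 / 2) =
      Real.exp (-‖u‖ ^ 2 / 2) * (Real.exp (-‖x‖ ^ 2 / 2) * Real.exp (inner ℝ u x)) := by
    rw [← Real.exp_add, ← Real.exp_add, norm_sub_sq_real, real_inner_comm u x]
    congr 1
    ring
  have hI : (Complex.I * (inner ℝ s (x - u) : ℝ)).re = 0 := by simp
  rw [rhoC_complexPoint_sub, norm_mul, norm_mul, norm_mul, Complex.norm_exp, hI, Real.exp_zero,
    Complex.norm_real, Complex.norm_real, Complex.norm_real, Real.norm_of_nonneg (by positivity),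
    Real.norm_of_nonneg (by positivity), Real.norm_of_nonneg (by positivity), rho_eq, h]
  ring

lemma rho_mul_exp_inner (w x : EuclideanSpace ℝ (Fin d)) :
    rho d x * Real.exp (inner ℝ w x) = Real.exp (‖w‖ ^ 2 / 2) * rho d (x - w) := by
  rw [rho_eq, rho_eq, norm_sub_sq_real, mul_assoc, ← Real.exp_add,
    mul_left_comm (Real.exp _), ← Real.exp_add, real_inner_comm w x]
  congr 2
  ring

lemma integrable_rho : Integrable (rho d) := by
  have h := (integrable_exp_neg_mul_sq_add_inner (d := d) (b := 1 / 2) (by norm_num) 0).const_mul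
    ((2 * Real.pi) ^ (-(d : ℝ) / 2))
  refine h.congr (Filter.Eventually.of_forall fun x => ?_)
  simp only [rho_eq, inner_zero_left, add_zero]
  congr 2
  ring

lemma exp_inner_rpow (u x : EuclideanSpace ℝ (Fin d)) (q : ℝ) :
    Real.exp (inner ℝ u x) ^ q = Real.exp (inner ℝ (q • u) x) := by
  rw [← Real.exp_mul, real_inner_smul_left, mul_comm]

lemma memLp_exp_inner {q : ℝ} (hq : 0 < q) (u : EuclideanSpace ℝ (Fin d)) :
    MemLp (fun x => Real.exp (inner ℝ u x)) (ENNReal.ofReal q) (gaussianMeasure d) := by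
  have hc : Continuous fun x => Real.exp (inner ℝ u x) := by fun_prop
  rw [← integrable_norm_rpow_iff hc.aestronglyMeasurable (by simpa using hq)
    ENNReal.ofReal_ne_top, ENNReal.toReal_ofReal hq.le, integrable_gaussianMeasure_iff]
  simp only [Real.norm_eq_abs, Real.abs_exp, exp_inner_rpow, smul_eq_mul, rho_mul_exp_inner]
  exact (integrable_rho.comp_sub_right (q • u)).const_mul _

lemma integral_exp_inner_rpow (q : ℝ) (u : EuclideanSpace ℝ (Fin d)) :
    ∫ x, Real.exp (inner ℝ u x) ^ q ∂gaussianMeasure d =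
      Real.exp (q ^ 2 * ‖u‖ ^ 2 / 2) * ∫ x, rho d x := by
  rw [integral_gaussianMeasure]
  simp only [exp_inner_rpow, smul_eq_mul, rho_mul_exp_inner]
  rw [integral_const_mul, integral_sub_right_eq_self (rho d), norm_smul, mul_pow,
    Real.norm_eq_abs, sq_abs]

lemma integrable_exp_inner_mul_norm {p : ℝ} (hp : 1 < p) {f : EuclideanSpace ℝ (Fin d) → ℂ}
    (hf : MemLp f (ENNReal.ofReal p) (gaussianMeasure d)) (u : EuclideanSpace ℝ (Fin d)) :
    Integrable (fun x => ‖f x‖ * Real.exp (inner ℝ u x)) (gaussianMeasure d) := by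
  have hpq : p.HolderConjugate (p.conjExponent) := Real.HolderConjugate.conjExponent hp
  have : ENNReal.HolderConjugate (ENNReal.ofReal p) (ENNReal.ofReal p.conjExponent) :=
    hpq.ennrealOfReal
  exact hf.norm.integrable_mul (memLp_exp_inner hpq.symm.pos u)

lemma integrable_rhoC_mul {p : ℝ} (hp : 1 < p) {f : EuclideanSpace ℝ (Fin d) → ℂ}
    (hf : MemLp f (ENNReal.ofReal p) (gaussianMeasure d)) (hfc : Continuous f)
    (z : EuclideanSpace ℂ (Fin d)) :
    Integrable fun x => rhoC d (z - complexPoint x 0) * f x := by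
  obtain ⟨u, s, rfl⟩ := exists_complexPoint_eq z
  have h := (integrable_gaussianMeasure_iff.1 (integrable_exp_inner_mul_norm hp hf u)).const_mul
    (Real.exp (‖s‖ ^ 2 / 2) * Real.exp (-‖u‖ ^ 2 / 2))
  refine h.mono' ?_ (Filter.Eventually.of_forall fun x => le_of_eq ?_)
  · refine (Continuous.mul ?_ hfc).aestronglyMeasurable
    unfold rhoC
    fun_prop
  · rw [norm_mul, norm_rhoC_complexPoint_sub, smul_eq_mul]
    ring

/-- Relative to `ρ dx` the kernel has modulus `e^{s²/2} e^{-u²/2} e^{u·x}`. For the conjugate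
exponent `q`, the `L^q` norm of `e^{u·x}` is a constant times `e^{q u²/2}`, and `q - 1 = 1/(p-1)`.
-/
lemma norm_transform_le {p : ℝ} (hp : 1 < p) {f : EuclideanSpace ℝ (Fin d) → ℂ}
    (hf : MemLp f (ENNReal.ofReal p) (gaussianMeasure d)) :
    ∃ C : ℝ, 0 ≤ C ∧ ∀ u s : EuclideanSpace ℝ (Fin d),
      ‖transform f (complexPoint u s)‖ ≤
        C * Real.exp (‖s‖ ^ 2 / 2) * Real.exp (‖u‖ ^ 2 / (2 * (p - 1))) := by
  have hpq : p.HolderConjugate (p.conjExponent) := Real.HolderConjugate.conjExponent hp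
  set q := p.conjExponent with hq
  have hM : 0 ≤ ∫ x, rho d x := integral_nonneg fun x => (rho_pos x).le
  have hN : 0 ≤ ∫ x, ‖f x‖ ^ p ∂gaussianMeasure d := integral_nonneg fun x => by positivity
  refine ⟨(∫ x, ‖f x‖ ^ p ∂gaussianMeasure d) ^ (1 / p) * (∫ x, rho d x) ^ (1 / q),
    by positivity, fun u s => ?_⟩
  have hInt := integrable_gaussianMeasure_iff.1 (integrable_exp_inner_mul_norm hp hf u)
  have hholder := integral_mul_le_Lp_mul_Lq_of_nonneg hpq (μ := gaussianMeasure d)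
    (f := fun x => ‖f x‖) (g := fun x => Real.exp (inner ℝ u x))
    (Filter.Eventually.of_forall fun x => norm_nonneg _)
    (Filter.Eventually.of_forall fun x => (Real.exp_pos _).le) hf.norm
    (memLp_exp_inner hpq.symm.pos u)
  rw [integral_exp_inner_rpow, Real.mul_rpow (Real.exp_pos _).le hM, ← Real.exp_mul,
    integral_gaussianMeasure] at hholder
  have hq0 : q ≠ 0 := hpq.symm.ne_zero
  have hp1 : p - 1 ≠ 0 := by linarith
  have hexp : Real.exp (-‖u‖ ^ 2 / 2) * Real.exp (q ^ 2 * ‖u‖ ^ 2 / 2 * (1 / q)) =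
      Real.exp (‖u‖ ^ 2 / (2 * (p - 1))) := by
    rw [← Real.exp_add]
    congr 1
    have : q ^ 2 * ‖u‖ ^ 2 / 2 * (1 / q) = q * ‖u‖ ^ 2 / 2 := by field_simp
    rw [this, hq, Real.conjExponent]
    field_simp
    ring
  calc ‖transform f (complexPoint u s)‖
      ≤ ∫ x, Real.exp (‖s‖ ^ 2 / 2) * Real.exp (-‖u‖ ^ 2 / 2) *
          (rho d x • (‖f x‖ * Real.exp (inner ℝ u x))) := by
        refine norm_integral_le_of_norm_le (hInt.const_mul _)
          (Filter.Eventually.of_forall fun x => le_of_eq ?_)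
        rw [norm_mul, norm_rhoC_complexPoint_sub, smul_eq_mul]
        ring
    _ = Real.exp (‖s‖ ^ 2 / 2) * Real.exp (-‖u‖ ^ 2 / 2) *
          ∫ x, rho d x • (‖f x‖ * Real.exp (inner ℝ u x)) := integral_const_mul _ _
    _ ≤ Real.exp (‖s‖ ^ 2 / 2) * Real.exp (-‖u‖ ^ 2 / 2) * _ :=
        mul_le_mul_of_nonneg_left hholder (by positivity)
    _ = _ := by
        rw [← hexp]
        ring

/-! ### Integration by parts and polynomial decay. -/

lemma hasFDerivAt_rhoC_sub (z : EuclideanSpace ℂ (Fin d)) (x : EuclideanSpace ℝ (Fin d)) :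
    ∃ L : EuclideanSpace ℝ (Fin d) →L[ℝ] ℂ,
      HasFDerivAt (fun x => rhoC d (z - complexPoint x 0)) L x ∧
      ∀ k, L (EuclideanSpace.single k 1) = (z k - (x k : ℂ)) * rhoC d (z - complexPoint x 0) := by
  have hfun : (fun x => rhoC d (z - complexPoint x 0)) = fun x : EuclideanSpace ℝ (Fin d) =>
      (((2 * Real.pi) ^ (-(d : ℝ) / 2) : ℝ) : ℂ) *
        Complex.exp ((∑ j, (z j - (x j : ℂ)) ^ 2) * (-(1 / 2))) := by
    funext x
    rw [rhoC]
    congr 2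
    simp only [PiLp.sub_apply, complexPoint_apply, PiLp.zero_apply, Complex.ofReal_zero, mul_zero,
      add_zero]
    ring
  have hsum : HasFDerivAt (fun x : EuclideanSpace ℝ (Fin d) => ∑ j, (z j - (x j : ℂ)) ^ 2) _ x :=
    HasFDerivAt.fun_sum fun j _ => ((hasFDerivAt_coord j x).const_sub (z j)).pow 2
  have hL := ((hsum.mul_const (-(1 / 2) : ℂ)).cexp).const_mul
    (((2 * Real.pi) ^ (-(d : ℝ) / 2) : ℝ) : ℂ)
  rw [← hfun] at hL
  refine ⟨_, hL, fun k => ?_⟩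
  rw [congrFun hfun x]
  have hk : (∑ i, (2 • (z i - (x i : ℂ)) ^ (2 - 1)) •
      -(Complex.ofRealCLM ∘SL EuclideanSpace.proj (𝕜 := ℝ) i))
        (EuclideanSpace.single k (1 : ℝ)) = -(2 * (z k - (x k : ℂ))) := by
    rw [sum_apply, Finset.sum_eq_single k]
    · simp
    · intro j _ hj
      simp [hj]
    · simp
  rw [smul_apply, smul_apply, smul_apply, hk]
  simp only [smul_eq_mul]
  ring

/-- The `x_k`-derivative of the kernel is `z_k - x_k` times the kernel; integrating by parts moves
it onto `f`. The three `L^p` hypotheses supply the integrability that rules out boundary terms. -/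
lemma coord_mul_transform {p : ℝ} (hp : 1 < p) {f : EuclideanSpace ℝ (Fin d) → ℂ}
    (hfs : ContDiff ℝ ∞ f) (k : Fin d)
    (hf : MemLp f (ENNReal.ofReal p) (gaussianMeasure d))
    (hxf : MemLp (fun x => (x k : ℂ) * f x) (ENNReal.ofReal p) (gaussianMeasure d))
    (hdf : MemLp (partialDeriv k f) (ENNReal.ofReal p) (gaussianMeasure d))
    (z : EuclideanSpace ℂ (Fin d)) :
    z k * transform f z = transform (fun x => (x k : ℂ) * f x - partialDeriv k f x) z := by
  have hfd : Differentiable ℝ f := hfs.differentiable (by simp)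
  have h1 := integrable_rhoC_mul hp hf hfs.continuous z
  have h2 := integrable_rhoC_mul hp hxf ((contDiff_coord k).mul hfs).continuous z
  have h3 := integrable_rhoC_mul hp hdf (contDiff_partialDeriv hfs k).continuous z
  have hfder : ∀ x, fderiv ℝ (fun x => rhoC d (z - complexPoint x 0)) x
      (EuclideanSpace.single k 1) = (z k - (x k : ℂ)) * rhoC d (z - complexPoint x 0) := by
    intro x
    obtain ⟨L, hL, hLk⟩ := hasFDerivAt_rhoC_sub z x
    rw [hL.fderiv, hLk]
  have hpd : ∀ x, fderiv ℝ f x (EuclideanSpace.single k 1) = partialDeriv k f x := fun x => by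
    rw [partialDeriv_eq_fderiv hfd]
  have hsplit : ∀ x, (z k - (x k : ℂ)) * rhoC d (z - complexPoint x 0) * f x =
      z k * (rhoC d (z - complexPoint x 0) * f x) -
        rhoC d (z - complexPoint x 0) * ((x k : ℂ) * f x) := fun x => by ring
  have hparts := integral_mul_fderiv_eq_neg_fderiv_mul_of_integrable (𝕜 := ℂ) (μ := volume)
    (f := fun x => rhoC d (z - complexPoint x 0)) (g := f) (v := EuclideanSpace.single k (1 : ℝ))
    (by simp only [hfder, hsplit]; exact (h1.const_mul _).sub h2) (by simpa only [hpd] using h3) h1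
    (fun x _ => (hasFDerivAt_rhoC_sub z x).choose_spec.1.differentiableAt) (fun x _ => hfd x)
  simp only [hfder, hsplit, hpd] at hparts
  rw [integral_sub (h1.const_mul _) h2, integral_const_mul] at hparts
  simp only [transform, mul_sub]
  rw [integral_sub h2 h3, hparts]
  ring

lemma norm_le_sum_abs (x : EuclideanSpace ℝ (Fin d)) : ‖x‖ ≤ ∑ j, |x j| := by
  refine le_of_sq_le_sq ?_ (Finset.sum_nonneg fun j _ => abs_nonneg _)
  rw [EuclideanSpace.real_norm_sq_eq]
  simpa using Finset.sum_sq_le_sq_sum_of_nonneg (s := Finset.univ) (f := fun j => |x j|)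
    fun j _ => abs_nonneg _

lemma CoordSpan.memLp_monomial_mul {p : ℝ} {B : Set (EuclideanSpace ℝ (Fin d) → ℂ)}
    (hB : ∀ f ∈ B, ∀ α, MemLp (fun x => (monomial α x : ℂ) * f x) (ENNReal.ofReal p)
      (gaussianMeasure d))
    {f : EuclideanSpace ℝ (Fin d) → ℂ} (hf : CoordSpan B f) (α : Fin d → ℕ) :
    MemLp (fun x => (monomial α x : ℂ) * f x) (ENNReal.ofReal p) (gaussianMeasure d) := by
  induction hf generalizing α with
  | base hf => exact hB _ hf α
  | coord j _ ih =>
    convert ih (α + Pi.single j 1) using 2 with x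
    rw [monomial_add_single]
    push_cast
    ring
  | add _ _ ih ih' => simp only [mul_add]; exact (ih α).add (ih' α)
  | sub _ _ ih ih' => simp only [mul_sub]; exact (ih α).sub (ih' α)

/-- A bound for a family of functions that is closed under multiplication by `c₁, …, c_d`
improves by any power of `1 + |c₁| + ⋯ + |c_d|`. -/
lemma exists_mul_pow_le {ι X κ : Type*} [Fintype κ] (P : ι → X → ℂ) (c : κ → X → ℂ) (w : X → ℝ)
    (hbase : ∀ i, ∃ C : ℝ, 0 ≤ C ∧ ∀ z, ‖P i z‖ ≤ C * w z)
    (hcoord : ∀ i j, ∃ i', ∀ z, c j z * P i z = P i' z) (n : ℕ) (i : ι) :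
    ∃ C : ℝ, 0 ≤ C ∧ ∀ z, ‖P i z‖ * (1 + ∑ j, ‖c j z‖) ^ n ≤ C * w z := by
  induction n generalizing i with
  | zero => simpa using hbase i
  | succ n ih =>
    obtain ⟨C, hC0, hC⟩ := ih i
    choose i' hi' using hcoord i
    choose D hD0 hD using fun j => ih (i' j)
    refine ⟨C + ∑ j, D j, add_nonneg hC0 (Finset.sum_nonneg fun j _ => hD0 j), fun z => ?_⟩
    -- One factor `1 + Σ|c_j|` is expanded, and each `c_j` is absorbed into another member of the
    -- family, to which the case `n` applies.
    have hexpand : ‖P i z‖ * (1 + ∑ j, ‖c j z‖) ^ (n + 1) =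
        ‖P i z‖ * (1 + ∑ j, ‖c j z‖) ^ n + ∑ j, ‖P (i' j) z‖ * (1 + ∑ j, ‖c j z‖) ^ n := by
      simp only [← hi', norm_mul]
      rw [← Finset.sum_mul, ← Finset.sum_mul]
      ring
    rw [hexpand, add_mul, Finset.sum_mul]
    exact add_le_add (hC z) (Finset.sum_le_sum fun j _ => hD j z)

lemma one_add_norm_mul_le (x y : EuclideanSpace ℝ (Fin d)) :
    (1 + ‖x‖) * (1 + ‖y‖) ≤ (1 + ∑ j, ‖complexPoint x y j‖) ^ 2 := by
  have hx : ‖x‖ ≤ ∑ j, ‖complexPoint x y j‖ := (norm_le_sum_abs x).trans <|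
    Finset.sum_le_sum fun j _ => by simpa using Complex.abs_re_le_norm (complexPoint x y j)
  have hy : ‖y‖ ≤ ∑ j, ‖complexPoint x y j‖ := (norm_le_sum_abs y).trans <|
    Finset.sum_le_sum fun j _ => by simpa using Complex.abs_im_le_norm (complexPoint x y j)
  rw [sq]
  gcongr

theorem exists_norm_transform_le {p : ℝ} (hp : 1 < p) {f : EuclideanSpace ℝ (Fin d) → ℂ}
    (hfs : ContDiff ℝ ∞ f)
    (hf : ∀ α β : Fin d → ℕ, MemLp (fun x => (monomial α x : ℂ) * multiDeriv β f x)
      (ENNReal.ofReal p) (gaussianMeasure d)) (n : ℕ) :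
    ∃ C : ℝ, ∀ x y : EuclideanSpace ℝ (Fin d),
      ‖transform f (complexPoint x y)‖ ≤
        C * Real.exp (‖y‖ ^ 2 / 2) * Real.exp (‖x‖ ^ 2 / (2 * (p - 1))) *
          (1 / ((1 + ‖x‖) ^ n * (1 + ‖y‖) ^ n)) := by
  let B : Set (EuclideanSpace ℝ (Fin d) → ℂ) := Set.range fun β => multiDeriv β f
  have hsmooth : ∀ g ∈ B, ContDiff ℝ ∞ g := by
    rintro _ ⟨β, rfl⟩
    exact contDiff_multiDeriv hfs β
  have hderiv : ∀ g ∈ B, ∀ k, CoordSpan B (partialDeriv k g) := by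
    rintro _ ⟨β, rfl⟩ k
    refine .base ⟨β + Pi.single k 1, ?_⟩
    exact (partialDeriv_multiDeriv hfs β k).symm
  have hmem : ∀ g, CoordSpan B g → MemLp g (ENNReal.ofReal p) (gaussianMeasure d) := by
    intro g hg
    have := hg.memLp_monomial_mul (p := p) (by rintro _ ⟨β, rfl⟩ α; exact hf α β) 0
    simpa only [monomial_zero, Complex.ofReal_one, one_mul] using this
  -- The family consists of transforms of all functions in the coordinate span of the derivatives of
  -- `f`, a class stable under `x_k - ∂_k`.
  obtain ⟨C, hC0, hC⟩ := exists_mul_pow_le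
    (fun (g : {g // CoordSpan B g}) (z : EuclideanSpace ℝ (Fin d) × EuclideanSpace ℝ (Fin d)) =>
      transform g.1 (complexPoint z.1 z.2))
    (fun (j : Fin d) z => complexPoint z.1 z.2 j)
    (fun z => Real.exp (‖z.2‖ ^ 2 / 2) * Real.exp (‖z.1‖ ^ 2 / (2 * (p - 1))))
    (fun g => by
      obtain ⟨C, hC0, hC⟩ := norm_transform_le hp (hmem g.1 g.2)
      exact ⟨C, hC0, fun z => by simpa only [mul_assoc] using hC z.1 z.2⟩)
    (fun g j => ⟨⟨_, (g.2.coord j).sub (g.2.partialDeriv hsmooth fun h hh => hderiv h hh j)⟩,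
      fun z => coord_mul_transform hp (g.2.contDiff hsmooth) j (hmem _ g.2)
        (hmem _ (g.2.coord j))
        (hmem _ (g.2.partialDeriv hsmooth fun h hh => hderiv h hh j)) _⟩)
    -- Twice `n`, since `1 + |x|` and `1 + |y|` each cost one factor `1 + Σ|z_j|`.
    (2 * n) ⟨f, .base ⟨0, multiDeriv_zero f⟩⟩
  refine ⟨C, fun x y => ?_⟩
  rw [mul_one_div, le_div_iff₀ (by positivity), ← mul_pow, mul_assoc C]
  refine le_trans ?_ (hC (x, y))
  rw [pow_mul]
  gcongr
  exact one_add_norm_mul_le x y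

end SegalBargmann

end

theorem mainTheorem3 (d : ℕ) (p : ℝ) (hp : 1 < p)
    (F : EuclideanSpace ℂ (Fin d) → ℂ) (hF : Differentiable ℂ F) :
    (∀ n : ℕ, ∃ C : ℝ, ∀ x y : EuclideanSpace ℝ (Fin d),
      ‖F (SegalBargmann.complexPoint x y)‖ ≤
        C * Real.exp (‖y‖ ^ 2 / 2) * Real.exp (‖x‖ ^ 2 / (2 * (p - 1))) *
          (1 / ((1 + ‖x‖) ^ n * (1 + ‖y‖) ^ n))) ↔
    (∃ f : EuclideanSpace ℝ (Fin d) → ℂ,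
      MemLp f (ENNReal.ofReal p) (SegalBargmann.gaussianMeasure d) ∧
      SegalBargmann.transform f = F ∧
      ContDiff ℝ ∞ f ∧
      ∀ α β : Fin d → ℕ,
        MemLp (fun x => (SegalBargmann.monomial α x : ℂ) * SegalBargmann.multiDeriv β f x)
          (ENNReal.ofReal p) (SegalBargmann.gaussianMeasure d)) := by
  constructor
  · exact fun h => SegalBargmann.RapidBound.exists_preimage hp ⟨hF, h⟩
  · rintro ⟨f, -, rfl, hfs, hf⟩ n
    exact SegalBargmann.exists_norm_transform_le hp hfs hf n
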